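/- For a simple undirected graph $G$ with graph distance $\mathrm{dist}_G$, a packing $p$-coloring of $G$ is a partition of its vertex set into classes $X_1,\dots,X_p$ (some possibly empty) such that, for each $i$, any two distinct vertices $u,v\in X_i$ satisfy $\mathrm{dist}_G(u,v)>i$. The packing chromatic number $\chi_\rho(G)$ is the smallest integer $p$ for which $G$ has a packing $p$-coloring. For positive integers $k<t$, the infinite distance graph $D(k,t)$ has vertex set $\mathbb{Z}$, and two distinct integers $i,j$ are adjacent if and only if $|i-j|\in\{k,t\}$. For every odd positive integer $t\ge 825$, $\chi_\rho(D(1,t))\le 30$. -/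

import Mathlib

/-- `X` is an `i`-packing of `G`: any two distinct vertices of `X` are at distance greater than `i`
(the extended distance, so vertices in different components are infinitely far apart). -/
def IsPacking {V : Type*} (G : SimpleGraph V) (i : ℕ) (X : Set V) : Prop :=
  ∀ ⦃u⦄, u ∈ X → ∀ ⦃v⦄, v ∈ X → u ≠ v → (i : ℕ∞) < G.edist u v

/-- `c` is a packing `p`-coloring of `G`: the colors are `1, …, p`, and each color class
`X_i = {v | c v = i}` (possibly empty) is an `i`-packing. -/
def IsPackingColoring {V : Type*} (G : SimpleGraph V) (p : ℕ) (c : V → ℕ) : Prop :=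
  (∀ v, c v ∈ Finset.Icc 1 p) ∧ ∀ i ∈ Finset.Icc 1 p, IsPacking G i {v | c v = i}

/-- The packing chromatic number: the smallest `p` for which a packing `p`-coloring exists
(`⊤` if there is none). -/
noncomputable def packingChromaticNumber {V : Type*} (G : SimpleGraph V) : ℕ∞ :=
  ⨅ (p : ℕ) (_ : ∃ c : V → ℕ, IsPackingColoring G p c), (p : ℕ∞)

/-- The infinite distance graph `D(d₁, …, dₖ)` on the integers, for the set `D = {d₁, …, dₖ}`:
distinct `i`, `j` are adjacent if and only if `|i - j| ∈ D`. -/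
def distanceGraph (D : Set ℕ) : SimpleGraph ℤ where
  Adj i j := i ≠ j ∧ (i - j).natAbs ∈ D
  symm := ⟨fun i j h => ⟨h.1.symm, by rw [← Int.natAbs_neg, neg_sub]; exact h.2⟩⟩
  loopless := ⟨fun _ h => h.1 rfl⟩

/-! Writing `n = a + t * b` turns `D(1, t)` into a square lattice wound on a helix, with `(a + t,
b)` identified with `(a, b + 1)`. Since `t` is odd, the even integers are pairwise nonadjacent and
take colour 1. The odd ones carry a doubly periodic packing colouring by 2 to 17 of horizontal
period 24, checked by computation. The excess `r = t % 24` is absorbed by `r` extra columns 31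
apart, coloured by 17 to 30. Deleting an extra column saves one horizontal step, which pays for the
vertical unit shift that keeps parity (`shifted_tile_ne`). As `r` is odd, column 0 is always extra
and pays in the same way for the row shift at the seam (`wrapped_tile_ne`). Colour 17, the only
shared one, is kept apart by rows (`sparse_ne_tile`). -/

/-- A packing colouring of the odd vertices of the square lattice, with periods `24` and `96` and
colours `2` to `17`, where `17` only occurs at `(12, 19)`. The entry for the vertex `(x, y)` with
`x + y` odd is the digit number `y / 2` in base `100` of the number at position `x` in the list. -/
def tileEntry (x y : ℕ) : ℕ :=
  [110405020302150413020302110405020302160412020302110405020302080414020302110405020302080416020302,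
    20306120703020305090403020306140703020305090403020306160703020305090403020306120903020305090403,
    51302030204051102030210050802030204051102030210050802030204051102030210051502030204051102030210,
    30804050302030704060302031504050302030704060302031204050302030704060302030804050302030704060302,
    40203020906100203020507040203020906100203020507040203020906100203020516040203021406100203020507,
    60507030203040516030203060507030203040508030203060507030203040508030203060507030203040515030203,
    20302110405020302080412020302110405020302150414020302110405020302130407020302110405020302080414,
    90403020307140603020305090403020307130603020305090403020307120603020305090403020307090603020305,
    30210050802030204051102030210050802030204051102030210051502030204051102030210050802030204051102,
    70302031304050302030604070302031204050302030604070302030804050302030604120302031304050302030604,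
    20506040203020907100203020506040203020907100203020506040203020907100203020506040203021207100203,
    30203070506030203040513030203070506030203040516030203070506030203040514030203070506030203040516,
    80412020302110405020302080416020302110405020302080413020302110405020302080417020302110405020302,
    20305090403020306150703020305090403020306120703020305090403020306150703020305090403020306130703,
    51102030210050802030204051102030210051402030204051102030210051602030204051102030210051402030204,
    30704060302031204050302030704060302030804050302030704060302030804050302030704060302030804050302,
    100203020507040203020906100203020507040203020906100203020507040203020906100203020507040203020906,
    40514030203060507030203040508030203060507030203040514030203060507030203040516030203060507030203,
    20302080416020302110405020302130415020302110405020302080412020302110405020302080415020302110405,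
    150603020305090403020307120603020305090403020307150603020305090403020307130603020305090403020307,
    30204051102030210051402030204051102030210051302030204051102030210050802030204051102030210051202,
    50302030604070302030804050302030604070302030804050302030604070302031204050302030604130302030804,
    20907100203020506040203020907100203020506040203020907100203020506040203020907100203020506040203,
    30203040508030203070506030203040508030203070506030203040513030203070506030203040507030203070506].getD x 0 / 100 ^ (y / 2) % 100

/-- The colour `c` at the vertex `(x, y)` does not recur at a vertex at most `c` steps away in a
column not to the left. -/
def NoRecurrence (x y c : ℕ) : Prop :=
  ∀ p ≤ c, ∀ q ≤ 2 * c,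
    p + (q - c) + (c - q) ≤ c ∧ (p + q + c) % 2 = 0 ∧ (p ≠ 0 ∨ q ≠ c) →
      tileEntry ((x + p) % 24) ((y + q + 96 - c) % 96) ≠ c

instance (x y c : ℕ) : Decidable (NoRecurrence x y c) := by
  unfold NoRecurrence; infer_instance

theorem tileEntry_spec : ∀ x < 24, ∀ y < 96, (x + y) % 2 = 1 →
    2 ≤ tileEntry x y ∧ tileEntry x y ≤ 17 ∧ (tileEntry x y = 17 → y = 19) ∧
      NoRecurrence x y (tileEntry x y) := by
  decide +kernel

/-- The doubly periodic extension of `tileEntry`. -/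
def tile (u v : ℤ) : ℕ := tileEntry (u % 24).toNat (v % 96).toNat

theorem tile_mem {u v : ℤ} (h : (u + v) % 2 = 1) :
    2 ≤ tile u v ∧ tile u v ≤ 17 ∧ (tile u v = 17 → v % 96 = 19) := by
  have := tileEntry_spec (u % 24).toNat (by omega) (v % 96).toNat (by omega) (by omega)
  exact ⟨this.1, this.2.1, fun h => by have := this.2.2.1 h; omega⟩

theorem tile_congr {u u' : ℤ} (h : u % 24 = u' % 24) (v : ℤ) : tile u v = tile u' v := by
  unfold tile; rw [h]

theorem tile_ne {u v p q : ℤ} (h : (u + v) % 2 = 1) (hp : 0 ≤ p) (hpq : (p + q) % 2 = 0)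
    (h0 : p ≠ 0 ∨ q ≠ 0) (hle : p + |q| ≤ tile u v) : tile (u + p) (v + q) ≠ tile u v := by
  have hs := tileEntry_spec (u % 24).toNat (by omega) (v % 96).toNat (by omega) (by omega)
  have h17 := hs.2.1
  have hq := le_abs_self q
  have hq' := neg_abs_le q
  have habs : |q| = q ∨ |q| = -q := abs_choice q
  have key := hs.2.2.2
  unfold tile at hle ⊢
  generalize tileEntry (u % 24).toNat (v % 96).toNat = c at *
  -- `NoRecurrence` encodes the signed vertical displacement `q` as the natural number `q + c`.
  have := key p.toNat (by omega) (q + c).toNat (by omega) (by omega)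
  have e1 : ((u % 24).toNat + p.toNat) % 24 = ((u + p) % 24).toNat := by omega
  have e2 : ((v % 96).toNat + (q + c).toNat + 96 - c) % 96 = ((v + q) % 96).toNat := by omega
  rwa [e1, e2] at this

/-- A periodic sequence in which every colour `c`, with `17 ≤ c ≤ 30`, only recurs at distances
exceeding `c / 2`, and `17` does not occur at the first `19` places. -/
def sparseEntry (z : ℕ) : ℕ :=
  [19, 29, 18, 25, 20, 23, 26, 24, 22, 21, 30, 19, 27, 28, 18, 20,
    25, 23, 29, 17, 22, 24, 21, 26, 18, 19, 30, 20, 27, 23, 28, 17,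
    22, 25, 29, 21, 24, 19, 18, 26, 20, 23, 30, 27, 22, 28, 21, 17].getD z 0

theorem sparseEntry_spec : ∀ z < 48, 17 ≤ sparseEntry z ∧ sparseEntry z ≤ 30 ∧
    (sparseEntry z = 17 → 19 ≤ z) ∧
    ∀ m ≤ 15, 0 < m → 2 * m ≤ sparseEntry z → sparseEntry ((z + m) % 48) ≠ sparseEntry z := by
  decide +kernel

/-- The periodic extension of `sparseEntry`. -/
def sparse (z : ℤ) : ℕ := sparseEntry (z % 48).toNat

theorem sparse_mem (z : ℤ) :
    17 ≤ sparse z ∧ sparse z ≤ 30 ∧ (sparse z = 17 → 19 ≤ z % 48) :=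
  have h := sparseEntry_spec (z % 48).toNat (by omega)
  ⟨h.1, h.2.1, fun h17 => by have := h.2.2.1 h17; omega⟩

theorem sparse_ne_of_pos {z m : ℤ} (hm : 0 < m) (h : 2 * m ≤ sparse z) :
    sparse (z + m) ≠ sparse z := by
  have h30 := (sparse_mem z).2.1
  have := (sparseEntry_spec (z % 48).toNat (by omega)).2.2.2 m.toNat (by omega) (by omega)
    (by unfold sparse at h; omega)
  have e : ((z % 48).toNat + m.toNat) % 48 = ((z + m) % 48).toNat := by omega
  rwa [e] at this

theorem sparse_ne {z m : ℤ} (hm : m ≠ 0) (h : 2 * |m| ≤ sparse z) :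
    sparse (z + m) ≠ sparse z := by
  rcases lt_or_gt_of_ne hm with hneg | hpos
  · intro heq
    rw [abs_of_neg hneg, ← heq] at h
    have := sparse_ne_of_pos (z := z + m) (m := -m) (by omega) h
    rw [add_neg_cancel_right] at this
    exact this heq.symm
  · rw [abs_of_pos hpos] at h
    exact sparse_ne_of_pos hpos h

/-! ### The strip colouring and its seam -/

/-- The number of inserted columns (the columns `31 * j` with `j < r`) up to column `a`. -/
def insertedUpTo (r a : ℤ) : ℤ := min r (a / 31 + 1)

/-- The colouring of the integers, written as `n = a + t * b` with `0 ≤ a < t`. Even integers get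
colour `1`. Among the odd ones, those in the `t % 24` inserted columns are coloured by `sparse`, and
the others by `tile` with the inserted columns removed. Each inserted column moves the tile by one
step vertically, alternately up and down, so that removing it does not increase distances. -/
def stripColoring (t n : ℤ) : ℕ :=
  if n % 2 = 0 then 1
  else if n % t % 31 = 0 ∧ n % t / 31 < t % 24 then sparse (n / t / 2)
  else tile (n % t - insertedUpTo (t % 24) (n % t))
    (n / t + insertedUpTo (t % 24) (n % t) % 2)

theorem emod_two_of_odd {t : ℤ} (ht : Odd t) (a b : ℤ) : (a + t * b) % 2 = (a + b) % 2 := by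
  obtain ⟨s, rfl⟩ := ht
  have : a + (2 * s + 1) * b = a + b + 2 * (s * b) := by ring
  omega

theorem tile_arg_odd {t n : ℤ} (ht : Odd t) (hn : n % 2 ≠ 0) (k : ℤ) :
    (n % t - k + (n / t + k % 2)) % 2 = 1 := by
  have h := emod_two_of_odd ht (n % t) (n / t)
  rw [Int.emod_add_mul_ediv] at h
  omega

theorem stripColoring_mem {t : ℤ} (ht : Odd t) (n : ℤ) :
    1 ≤ stripColoring t n ∧ stripColoring t n ≤ 30 := by
  unfold stripColoring
  split_ifs with h1 h2
  · omega
  · have := sparse_mem (n / t / 2); omega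
  · have := tile_mem (tile_arg_odd ht h1 (insertedUpTo (t % 24) (n % t))); omega

theorem divMod_add {t n x y : ℤ} (ht : 30 < t) (hx : 0 ≤ x) (hx30 : x ≤ 30) :
    ((n + x + t * y) % t = n % t + x ∧ (n + x + t * y) / t = n / t + y ∧ n % t + x < t) ∨
    ((n + x + t * y) % t = n % t + x - t ∧ (n + x + t * y) / t = n / t + y + 1 ∧
      t ≤ n % t + x) := by
  have h0 := Int.emod_nonneg n (show t ≠ 0 by omega)
  have h1 := Int.emod_lt_of_pos n (show 0 < t by omega)
  have e : n + x + t * y = n % t + x + t * (n / t + y) := by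
    rw [mul_add, ← add_assoc, add_right_comm (n % t), Int.emod_add_mul_ediv]
  rw [e, Int.add_mul_emod_self_left, Int.add_mul_ediv_left _ _ (show t ≠ 0 by omega)]
  rcases lt_or_ge (n % t + x) t with h | h
  · left
    rw [Int.emod_eq_of_lt (by omega) h, Int.ediv_eq_zero_of_lt (by omega) h]
    omega
  · right
    have e2 : n % t + x = n % t + x - t + t * 1 := by ring
    rw [e2, Int.add_mul_emod_self_left, Int.add_mul_ediv_left _ _ (show t ≠ 0 by omega),
      Int.emod_eq_of_lt (by omega) (by omega), Int.ediv_eq_zero_of_lt (by omega) (by omega)]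
    omega

/-- Odd integers in one column lie in rows of a single parity, so halving enumerates them and halves
distances. -/
theorem sparse_half_ne {b y : ℤ} (hy : y % 2 = 0) (h0 : y ≠ 0) (hle : |y| ≤ sparse (b / 2)) :
    sparse ((b + y) / 2) ≠ sparse (b / 2) := by
  have e : (b + y) / 2 = b / 2 + y / 2 := by omega
  rw [e]
  refine sparse_ne (by omega) ?_
  have habs := abs_choice y
  have habs2 := abs_choice (y / 2)
  have hnonneg := abs_nonneg y
  have hnonneg2 := abs_nonneg (y / 2)
  omega

theorem shifted_tile_ne {r a b x y : ℤ} (hx : 0 ≤ x) (hx30 : x ≤ 30) (hxy : (x + y) % 2 = 0)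
    (h0 : x ≠ 0 ∨ y ≠ 0) (ha : ¬((a + x) % 31 = 0 ∧ (a + x) / 31 < r))
    (hodd : (a - insertedUpTo r a + (b + insertedUpTo r a % 2)) % 2 = 1)
    (hle : x + |y| ≤ tile (a - insertedUpTo r a) (b + insertedUpTo r a % 2)) :
    tile (a + x - insertedUpTo r (a + x)) (b + y + insertedUpTo r (a + x) % 2) ≠
      tile (a - insertedUpTo r a) (b + insertedUpTo r a % 2) := by
  by_cases hk : insertedUpTo r (a + x) = insertedUpTo r a
  · rw [hk, add_sub_right_comm, add_right_comm]
    exact tile_ne hodd hx hxy h0 hle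
  · have hk1 : insertedUpTo r (a + x) = insertedUpTo r a + 1 := by
      unfold insertedUpTo at hk ⊢; omega
    -- As `x ≤ 30`, just one inserted column is crossed, and the endpoint lies strictly beyond it;
    -- so `x - 1` is still positive.
    have hx2 : 2 ≤ x := by
      unfold insertedUpTo at hk1; omega
    rw [hk1]
    clear hk hk1 ha
    generalize insertedUpTo r a = k at *
    have e1 : a + x - (k + 1) = a - k + (x - 1) := by ring
    have e2 : b + y + (k + 1) % 2 = b + k % 2 + (y + ((k + 1) % 2 - k % 2)) := by ring
    rw [e1, e2]
    have hd : (k + 1) % 2 - k % 2 = 1 ∨ (k + 1) % 2 - k % 2 = -1 := by omega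
    generalize (k + 1) % 2 - k % 2 = d at *
    have habs := abs_add_le y d
    have hd1 : |d| = 1 := by rcases hd with rfl | rfl <;> rfl
    exact tile_ne hodd (by omega) (by omega) (by omega) (by omega)

theorem wrapped_tile_ne {t a b x y : ℤ} (ht : t % 2 = 1) (ht713 : 713 ≤ t) (hat : a < t)
    (hx30 : x ≤ 30) (hge : t ≤ a + x) (hxy : (x + y) % 2 = 0)
    (ha : ¬((a + x - t) % 31 = 0 ∧ (a + x - t) / 31 < t % 24))
    (hodd : (a - insertedUpTo (t % 24) a + (b + insertedUpTo (t % 24) a % 2)) % 2 = 1)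
    (hle : x + |y| ≤
      tile (a - insertedUpTo (t % 24) a) (b + insertedUpTo (t % 24) a % 2)) :
    tile (a + x - t - insertedUpTo (t % 24) (a + x - t))
        (b + y + 1 + insertedUpTo (t % 24) (a + x - t) % 2) ≠
      tile (a - insertedUpTo (t % 24) a) (b + insertedUpTo (t % 24) a % 2) := by
  -- Here `a ≥ 713 - 30 = 683`, beyond the last possible inserted column `31 * 22 = 682`.
  have hk : insertedUpTo (t % 24) a = t % 24 := by unfold insertedUpTo; omega
  have hk' : insertedUpTo (t % 24) (a + x - t) = 1 := by unfold insertedUpTo; omega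
  rw [hk] at hodd hle
  rw [hk, hk']
  have hx2 : 2 ≤ x := by omega
  have e1 : (a + x - t - 1) % 24 = (a - t % 24 + (x - 1)) % 24 := by omega
  have e2 : b + y + 1 + 1 % 2 = b + t % 24 % 2 + (y + 1) := by omega
  rw [tile_congr e1, e2]
  have habs : |y + 1| ≤ |y| + 1 := abs_add_le y 1
  clear ha hk hk' e1 e2
  exact tile_ne hodd (by omega) (by omega) (by omega) (by omega)

/-- A common colour must be 17. Then `v` is 19 modulo 96, which puts `b` in residues 0 to 37, while
17 in `sparse` needs residues 38 to 95. The range of `d` allows 17 steps, the parity shift and the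
seam. -/
theorem sparse_ne_tile {b u v d : ℤ} (huv : (u + v) % 2 = 1) (hd : v = b + d)
    (hd1 : -18 ≤ d) (hd2 : d ≤ 19) : sparse (b / 2) ≠ tile u v := by
  intro heq
  have h1 := sparse_mem (b / 2)
  have h2 := tile_mem huv
  have h3 := h1.2.2 (by omega)
  have h4 := h2.2.2 (by omega)
  omega

theorem stripColoring_even {t n : ℤ} (hn : n % 2 = 0) : stripColoring t n = 1 := if_pos hn

theorem two_le_stripColoring {t n : ℤ} (ht : Odd t) (hn : n % 2 ≠ 0) :
    2 ≤ stripColoring t n := by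
  rw [stripColoring, if_neg hn]
  split_ifs
  · exact le_trans (by norm_num) (sparse_mem _).1
  · exact (tile_mem (tile_arg_odd ht hn _)).1

theorem stripColoring_ne_of_nonneg {t n x y : ℤ} (ht : Odd t) (ht713 : 713 ≤ t) (hx : 0 ≤ x)
    (h0 : x ≠ 0 ∨ y ≠ 0) (hle : x + |y| ≤ stripColoring t n) :
    stripColoring t (n + x + t * y) ≠ stripColoring t n := by
  intro heq
  have hpar : (n + x + t * y) % 2 = (n + x + y) % 2 := emod_two_of_odd ht _ _
  by_cases hn : n % 2 = 0
  · rw [stripColoring_even hn] at heq hle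
    have hm : (n + x + t * y) % 2 = 0 := by
      by_contra hm
      have := two_le_stripColoring ht hm
      omega
    have habs := abs_choice y
    have hnonneg := abs_nonneg y
    omega
  have hm : (n + x + t * y) % 2 ≠ 0 := by
    intro hm
    rw [stripColoring_even hm] at heq
    have := two_le_stripColoring ht hn
    omega
  have hxy : (x + y) % 2 = 0 := by omega
  have hx30 : x ≤ 30 := by
    have := (stripColoring_mem ht n).2
    have := abs_nonneg y
    omega
  have hdm := divMod_add (n := n) (y := y) (show 30 < t by omega) hx hx30
  have ha0 := Int.emod_nonneg n (show t ≠ 0 by omega)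
  have ha1 := Int.emod_lt_of_pos n (show 0 < t by omega)
  have htodd : t % 2 = 1 := Int.odd_iff.mp ht
  have hodd := tile_arg_odd ht hn (insertedUpTo (t % 24) (n % t))
  have hodd' := tile_arg_odd ht hm (insertedUpTo (t % 24) ((n + x + t * y) % t))
  rw [stripColoring, if_neg hm] at heq
  rw [stripColoring, if_neg hn] at heq hle
  clear hpar hn hm
  generalize n + x + t * y = m at *
  generalize n % t = a at *
  generalize n / t = b at *
  split_ifs at heq hle with h1 h2 h2
  -- Distinct inserted columns are at least 31 apart, also across the seam because `713 - 682 = 31`.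
  · have hx0 : x = 0 := by clear hle heq hodd hodd'; omega
    subst hx0
    have hb : m / t = b + y := by clear hle heq hodd hodd'; omega
    rw [hb] at heq
    rw [zero_add] at hxy hle
    exact sparse_half_ne hxy (h0.resolve_left (fun h => h rfl)) hle heq
  · have h17 := (tile_mem hodd).2.1
    have hy := le_abs_self y
    have hy' := neg_abs_le y
    exact sparse_ne_tile (d := b + insertedUpTo (t % 24) a % 2 - m / t) hodd (by ring) (by omega)
      (by omega) heq
  · have h17 : sparse (b / 2) ≤ 17 := heq ▸ (tile_mem hodd').2.1
    have hy := le_abs_self y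
    have hy' := neg_abs_le y
    exact sparse_ne_tile (d := m / t + insertedUpTo (t % 24) (m % t) % 2 - b) hodd' (by ring)
      (by omega) (by omega) heq.symm
  · rcases hdm with ⟨hma, hmb, hlt⟩ | ⟨hma, hmb, hge⟩ <;> rw [hma] at heq h1 <;> rw [hmb] at heq
    · exact shifted_tile_ne hx hx30 hxy h0 h1 hodd hle heq
    · exact wrapped_tile_ne htodd ht713 ha1 hx30 hge hxy h1 hodd hle heq

theorem stripColoring_ne {t n x y : ℤ} (ht : Odd t) (ht713 : 713 ≤ t)
    (h0 : x ≠ 0 ∨ y ≠ 0) (hle : |x| + |y| ≤ stripColoring t n) :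
    stripColoring t (n + x + t * y) ≠ stripColoring t n := by
  rcases le_total 0 x with hx | hx
  · rw [abs_of_nonneg hx] at hle
    exact stripColoring_ne_of_nonneg ht ht713 hx h0 hle
  · intro heq
    -- Both vertices have the same colour, so their roles can be exchanged.
    rw [abs_of_nonpos hx, ← abs_neg y, ← heq] at hle
    refine stripColoring_ne_of_nonneg ht ht713 (x := -x) (y := -y) (by omega) (by omega) hle ?_
    rw [heq]
    congr 1
    ring

/-! ### From lattice displacements to graph distance -/

theorem exists_of_walk {t : ℕ} {n m : ℤ} (p : (distanceGraph {1, t}).Walk n m) :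
    ∃ x y : ℤ, m = n + x + t * y ∧ |x| + |y| ≤ p.length := by
  induction p with
  | nil => exact ⟨0, 0, by simp, by simp⟩
  | @cons u v w h p ih =>
    obtain ⟨x, y, rfl, hle⟩ := ih
    have hadj : (u - v).natAbs = 1 ∨ (u - v).natAbs = t := h.2
    rw [SimpleGraph.Walk.length_cons]
    push_cast
    have key : ∀ d : ℤ, |d| = 1 → ∀ z : ℤ, |z + d| ≤ |z| + 1 := fun d hd z =>
      hd ▸ abs_add_le z d
    rcases hadj with h1 | h1 <;> rcases Int.natAbs_eq (u - v) with h2 | h2 <;> rw [h1] at h2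
    · exact ⟨x + -1, y, by push_cast at h2; linarith, by linarith [key (-1) (by simp) x]⟩
    · exact ⟨x + 1, y, by push_cast at h2; linarith, by linarith [key 1 (by simp) x]⟩
    · exact ⟨x, y + -1, by linarith, by linarith [key (-1) (by simp) y]⟩
    · exact ⟨x, y + 1, by linarith, by linarith [key 1 (by simp) y]⟩

theorem isPackingColoring_stripColoring {t : ℕ} (ht : Odd t) (ht713 : 713 ≤ t) :
    IsPackingColoring (distanceGraph {1, t}) 30 (stripColoring t) := by
  have htz : Odd (t : ℤ) := by exact_mod_cast ht
  refine ⟨fun n => Finset.mem_Icc.mpr (stripColoring_mem htz n), fun i _ n hn m hm hnm => ?_⟩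
  by_contra hlt
  rw [not_lt] at hlt
  obtain ⟨p, hp⟩ := SimpleGraph.exists_walk_of_edist_ne_top
    (ne_top_of_le_ne_top (ENat.natCast_ne_top i) hlt)
  rw [← hp, Nat.cast_le] at hlt
  obtain ⟨x, y, rfl, hle⟩ := exists_of_walk p
  have hn' : stripColoring t n = i := hn
  refine stripColoring_ne htz (by exact_mod_cast ht713) (x := x) (y := y) (n := n) ?_ ?_
    (hm.trans hn'.symm)
  · by_contra! h
    exact hnm (by rw [h.1, h.2]; ring)
  · rw [hn']
    exact hle.trans (by exact_mod_cast hlt)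

theorem mainTheorem5 (t : ℕ) (ht : Odd t) (ht825 : 825 ≤ t) :
    packingChromaticNumber (distanceGraph {1, t}) ≤ 30 :=
  iInf₂_le 30 ⟨_, isPackingColoring_stripColoring ht (by omega)⟩
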